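/- Let $k$ be a perfect field and let $\Gamma$ be a $k$-algebra (with $k$ acting centrally) which is a bounded principal ideal domain, that is, a not necessarily commutative domain in which all left ideals and all right ideals are principal and every nonzero one-sided ideal contains a nonzero two-sided ideal. For a left $\Gamma$-module $M$ let $\operatorname{Endol}(M)$ be its endolength, i.e. the length of $M$ as a right $\operatorname{End}_\Gamma(M)^{op}$-module (where $m\cdot f=f(m)$). Let $M_n$ be the indecomposable $\Gamma$-module of finite length $n\ge 1$ with socle $M_1$. Then $$\operatorname{Endol}(M_n)=n\cdot\operatorname{Endol}(M_1).$$ Here the socle of any indecomposable $\Gamma$-module of finite length is simple, an indecomposable $\Gamma$-module of finite length is determined up to isomorphism by its length and its socle, and, if $\Gamma$ is not a division ring, $M_n$ exists for every simple $\Gamma$-module $M_1$ and every $n\ge 1$. Moreover, if $\Gamma$ is not $e$-discrete, then $\Gamma$ satisfies EBTII. Here $\Gamma$ is called $e$-discrete if for each $d\in\mathbb N$ there are only finitely many isomorphism classes of indecomposable $\Gamma$-modules of finite $k$-dimension and of endolength $d$; and $\Gamma$ satisfies EBTII if there is an infinite sequence of natural numbers $d_1<d_2<\cdots$ such that for each $d_i$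 there are infinitely many pairwise non-isomorphic indecomposable $\Gamma$-modules of finite $k$-dimension and of endolength $d_i$. -/

import Mathlib

universe u v

/-- A (not necessarily commutative) bounded principal ideal domain: a domain in which every left
ideal and every right ideal is principal, and every nonzero one-sided ideal contains a nonzero
two-sided ideal. Right ideals are `Γᵐᵒᵖ`-submodules of `Γ`. Division rings are allowed. -/
structure IsBoundedPID (Γ : Type u) [Ring Γ] : Prop where
  isDomain : IsDomain Γ
  left_principal : ∀ I : Ideal Γ, ∃ a : Γ, I = Ideal.span {a}
  right_principal : ∀ I : Submodule Γᵐᵒᵖ Γ, ∃ a : Γ, I = Submodule.span Γᵐᵒᵖ {a}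
  left_bounded : ∀ I : Ideal Γ, I ≠ ⊥ → ∃ J : TwoSidedIdeal Γ, J ≠ ⊥ ∧ ∀ x ∈ J, x ∈ I
  right_bounded : ∀ I : Submodule Γᵐᵒᵖ Γ, I ≠ ⊥ →
    ∃ J : TwoSidedIdeal Γ, J ≠ ⊥ ∧ ∀ x ∈ J, x ∈ I

/-- A module is indecomposable if it is nonzero and is not the direct sum of two nonzero
submodules. -/
def IsIndecomposableModule (R : Type u) (M : Type v) [Ring R] [AddCommGroup M] [Module R M] :
    Prop :=
  Nontrivial M ∧ ∀ N P : Submodule R M, IsCompl N P → N = ⊥ ∨ P = ⊥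

/-- The socle of a module: the sum of all its simple submodules. -/
def moduleSocle (R : Type u) (M : Type v) [Ring R] [AddCommGroup M] [Module R M] :
    Submodule R M :=
  sSup {N : Submodule R M | IsSimpleModule R N}

/-- The endolength of `M`: its length as a right module over `(End M)ᵒᵖ`, acting by `m · f = f m`;
this is its length as a left module over `End M` with the evaluation action. -/
noncomputable def endolength (R : Type u) (M : Type v) [Ring R] [AddCommGroup M] [Module R M] :
    ℕ∞ :=
  Module.length (Module.End R M) M

/-- The set of isomorphism classes of indecomposable `A`-modules which are finite-dimensional
over `k` and have endolength `d`. -/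
def indecIsoclasses (k : Type v) (A : Type u) [Field k] [Ring A] [Algebra k A] (d : ℕ) :
    Set (Quotient (CategoryTheory.isIsomorphicSetoid (ModuleCat.{u} A))) :=
  {c | ∃ M : ModuleCat.{u} A, Module.Finite k (RestrictScalars k A M) ∧
    IsIndecomposableModule A M ∧ endolength A M = (d : ℕ∞) ∧ Quotient.mk _ M = c}

/-- `A` is `e`-discrete: for each endolength `d` there are only finitely many isomorphism classes
of indecomposable finite-dimensional `A`-modules of endolength `d`. -/
def IsEDiscrete (k : Type v) (A : Type u) [Field k] [Ring A] [Algebra k A] : Prop :=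
  ∀ d : ℕ, (indecIsoclasses k A d).Finite

/-- `A` satisfies EBTII: there is a sequence `d 0 < d 1 < ⋯` of natural numbers such that for each
`i` there are infinitely many pairwise non-isomorphic finite-dimensional indecomposable
`A`-modules of endolength `d i`. -/
def SatisfiesEBTII (k : Type v) (A : Type u) [Field k] [Ring A] [Algebra k A] : Prop :=
  ∃ d : ℕ → ℕ, StrictMono d ∧ ∀ i, (indecIsoclasses k A (d i)).Infinite

/-! If `Γ` is a division ring, every indecomposable module is simple and isomorphic to `Γ`.
Otherwise boundedness gives each simple module `S` a nonzero annihilator, generated on both sides by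
a normal element `p`; the descending chain condition above `p` makes `Γ / Γp` semisimple. Let `X` be
an injective hull of `S`. Injective means divisible here, so `p` acts surjectively on `X`, and its
kernel, being semisimple with `S` essential, is `S`. Hence the kernels `X_n` of `p ^ n` are the only
submodules of `X` killed by a power of `p`, and `X_n` has length `n` (`eq_layer`, `length_layer`).

Every indecomposable `M` of finite length is some `X_n` (`exists_layer_equiv`). By Fitting's lemma a
least power `p ^ (n + 1)` kills `M`. A minimal `W` with `p ^ n W ≠ 0` is hollow, hence uniserial,
hence a copy of `X_(n+1)`; injectivity of `X` splits it off, so `W = M`.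

Multiplication by `p` is not `Γ`-linear, but it commutes with `End X_n`. It filters `X_n` by `n`
copies of the socle, whose `End X_n`-length is its endolength because every endomorphism of the
socle extends (`endolength_layer`). For EBTII, infinitely many classes of one endolength `d = n * e`
give infinitely many with the same `n` and socle endolength `e`; keeping the socles and varying the
length yields the endolengths `m * e`. -/

/-- An element `p` of a ring with `p Γ = Γ p`. -/
structure IsNormalElement {Γ : Type u} [Ring Γ] (p : Γ) : Prop where
  left : ∀ x, ∃ y, p * x = y * p
  right : ∀ x, ∃ y, x * p = p * y

/-! ### Multiplication by a normal element -/

namespace IsNormalElement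

variable {Γ : Type u} [Ring Γ] {p : Γ} {M : Type v} [AddCommGroup M] [Module Γ M]

theorem pow (hp : IsNormalElement p) (n : ℕ) : IsNormalElement (p ^ n) := by
  induction n with
  | zero => exact ⟨fun x => ⟨x, by simp⟩, fun x => ⟨x, by simp⟩⟩
  | succ n ih =>
    refine ⟨fun x => ?_, fun x => ?_⟩
    · obtain ⟨y, hy⟩ := hp.left x
      obtain ⟨z, hz⟩ := ih.left y
      exact ⟨z, by rw [pow_succ, mul_assoc, hy, ← mul_assoc, hz, mul_assoc]⟩
    · obtain ⟨y, hy⟩ := ih.right x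
      obtain ⟨z, hz⟩ := hp.right y
      exact ⟨z, by rw [pow_succ, ← mul_assoc, hy, mul_assoc, hz, mul_assoc]⟩

variable (M) in
/-- The submodule of elements killed by a normal element. -/
def torsion (hp : IsNormalElement p) : Submodule Γ M where
  carrier := {m | p • m = 0}
  add_mem' {a b} ha hb := by
    simp only [Set.mem_ofPred_eq] at *
    rw [smul_add, ha, hb, add_zero]
  zero_mem' := smul_zero _
  smul_mem' x m hm := by
    simp only [Set.mem_ofPred_eq] at *
    obtain ⟨y, hy⟩ := hp.left x
    rw [← mul_smul, hy, mul_smul, hm, smul_zero]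

@[simp]
theorem mem_torsion (hp : IsNormalElement p) {m : M} : m ∈ hp.torsion M ↔ p • m = 0 := Iff.rfl

/-- The submodule `p T`, for a normal element `p` and a submodule `T`. -/
def smulMap (hp : IsNormalElement p) (T : Submodule Γ M) : Submodule Γ M where
  carrier := {m | ∃ t ∈ T, p • t = m}
  add_mem' := by
    rintro _ _ ⟨a, ha, rfl⟩ ⟨b, hb, rfl⟩
    exact ⟨a + b, T.add_mem ha hb, smul_add _ _ _⟩
  zero_mem' := ⟨0, T.zero_mem, smul_zero _⟩
  smul_mem' := by
    rintro x _ ⟨a, ha, rfl⟩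
    obtain ⟨y, hy⟩ := hp.right x
    exact ⟨y • a, T.smul_mem _ ha, by rw [← mul_smul, ← mul_smul, hy]⟩

/-- The submodule of those `m` with `p m ∈ T`, for a normal element `p` and a submodule `T`. -/
def smulComap (hp : IsNormalElement p) (T : Submodule Γ M) : Submodule Γ M where
  carrier := {m | p • m ∈ T}
  add_mem' {a b} ha hb := by
    simp only [Set.mem_ofPred_eq] at *
    rw [smul_add]
    exact T.add_mem ha hb
  zero_mem' := by simp
  smul_mem' x m hm := by
    simp only [Set.mem_ofPred_eq] at *
    obtain ⟨y, hy⟩ := hp.left x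
    rw [← mul_smul, hy, mul_smul]
    exact T.smul_mem _ hm

theorem smulMap_mono (hp : IsNormalElement p) {T T' : Submodule Γ M} (h : T ≤ T') :
    hp.smulMap T ≤ hp.smulMap T' := by
  rintro _ ⟨t, ht, rfl⟩
  exact ⟨t, h ht, rfl⟩

theorem smulMap_sup (hp : IsNormalElement p) (T T' : Submodule Γ M) :
    hp.smulMap (T ⊔ T') = hp.smulMap T ⊔ hp.smulMap T' := by
  apply le_antisymm
  · rintro _ ⟨t, ht, rfl⟩
    obtain ⟨a, ha, b, hb, rfl⟩ := Submodule.mem_sup.1 ht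
    rw [smul_add]
    exact Submodule.add_mem_sup ⟨a, ha, rfl⟩ ⟨b, hb, rfl⟩
  · exact sup_le (hp.smulMap_mono le_sup_left) (hp.smulMap_mono le_sup_right)

theorem torsion_pow_mono (hp : IsNormalElement p) {m n : ℕ} (h : m ≤ n) :
    (hp.pow m).torsion M ≤ (hp.pow n).torsion M := by
  intro x hx
  obtain ⟨c, rfl⟩ := Nat.exists_eq_add_of_le' h
  rw [mem_torsion] at *
  rw [pow_add, mul_smul, hx, smul_zero]

theorem smulMap_pow_anti (hp : IsNormalElement p) {m n : ℕ} (h : m ≤ n) (T : Submodule Γ M) :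
    (hp.pow n).smulMap T ≤ (hp.pow m).smulMap T := by
  rintro _ ⟨t, ht, rfl⟩
  obtain ⟨c, rfl⟩ := Nat.exists_eq_add_of_le h
  exact ⟨p ^ c • t, T.smul_mem _ ht, by rw [pow_add, mul_smul]⟩

/-- Fitting's lemma for the multiplication by a normal element. -/
theorem exists_isCompl (hp : IsNormalElement p) [IsNoetherian Γ M] [IsArtinian Γ M] :
    ∃ n, 1 ≤ n ∧ IsCompl ((hp.pow n).torsion M) ((hp.pow n).smulMap ⊤) := by
  obtain ⟨a, ha⟩ := monotone_stabilizes_iff_noetherian.2 ‹IsNoetherian Γ M›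
    ⟨fun n => (hp.pow n).torsion M, fun _ _ h => hp.torsion_pow_mono h⟩
  obtain ⟨b, hb⟩ := IsArtinian.monotone_stabilizes (R := Γ) (M := M)
    ⟨fun n => OrderDual.toDual ((hp.pow n).smulMap ⊤), fun _ _ h => hp.smulMap_pow_anti h ⊤⟩
  set n := a + b + 1 with hn
  have h1 : (hp.pow n).torsion M = (hp.pow (n + n)).torsion M :=
    (ha n (by omega)).symm.trans (ha (n + n) (by omega))
  have h2 : (hp.pow n).smulMap (⊤ : Submodule Γ M) = (hp.pow (n + n)).smulMap ⊤ :=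
    (hb n (by omega)).symm.trans (hb (n + n) (by omega))
  refine ⟨n, by omega, ?_, ?_⟩
  · rw [Submodule.disjoint_def]
    rintro _ hx ⟨t, -, rfl⟩
    rw [mem_torsion, ← mul_smul, ← pow_add] at hx
    have : t ∈ (hp.pow n).torsion M := by rw [h1]; exact hx
    exact this
  · rw [codisjoint_iff, eq_top_iff]
    intro x _
    have hx : p ^ n • x ∈ (hp.pow (n + n)).smulMap (⊤ : Submodule Γ M) := by
      rw [← h2]; exact ⟨x, trivial, rfl⟩
    obtain ⟨t, -, ht⟩ := hx
    rw [pow_add, mul_smul] at ht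
    rw [Submodule.mem_sup]
    exact ⟨x - p ^ n • t, by rw [mem_torsion, smul_sub, ht, sub_self], p ^ n • t,
      ⟨t, trivial, rfl⟩, sub_add_cancel _ _⟩

end IsNormalElement

/-- Each cyclic submodule is a quotient of `Γ / Γp`, and a sum of semisimple submodules is
semisimple. -/
theorem isSemisimpleModule_of_smul_eq_zero {Γ : Type u} [Ring Γ] {p : Γ}
    (hs : IsSemisimpleModule Γ (Γ ⧸ Ideal.span {p}))
    {M : Type v} [AddCommGroup M] [Module Γ M] (hM : ∀ m : M, p • m = 0) :
    IsSemisimpleModule Γ M := by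
  have key : ∀ m : M, Ideal.span {p} ≤ LinearMap.ker (LinearMap.toSpanSingleton Γ M m) := by
    intro m x hx
    obtain ⟨y, rfl⟩ := Ideal.mem_span_singleton'.1 hx
    simp [mul_smul, hM]
  refine isSemisimpleModule_of_isSemisimpleModule_submodule'
    (p := fun m : M => LinearMap.range ((Ideal.span {p}).liftQ _ (key m))) (fun m => ?_) ?_
  · exact IsSemisimpleModule.range _
  · rw [eq_top_iff]
    intro m _
    refine Submodule.mem_iSup_of_mem m ⟨Submodule.Quotient.mk 1, ?_⟩
    simp

/-! ### Ideals and annihilators in a bounded principal ideal domain -/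

namespace IsBoundedPID

variable {Γ : Type u} [Ring Γ]

theorem isNoetherian_op (hΓ : IsBoundedPID Γ) : IsNoetherian Γᵐᵒᵖ Γ := by
  rw [isNoetherian_def]
  intro I
  obtain ⟨a, rfl⟩ := hΓ.right_principal I
  exact ⟨{a}, by simp⟩

/-- The left ideals containing a given nonzero element satisfy the descending chain condition. -/
theorem wellFoundedLT_Ici (hΓ : IsBoundedPID Γ) {a : Γ} (ha : a ≠ 0) :
    WellFoundedLT {I : Ideal Γ // a ∈ I} := by
  have := hΓ.isDomain
  have := hΓ.isNoetherian_op
  choose g hg using hΓ.left_principal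
  have hq : ∀ I : {I : Ideal Γ // a ∈ I}, ∃ y, y * g I.1 = a := fun I => by
    have := I.2
    rw [hg I.1] at this
    exact Ideal.mem_span_singleton'.1 this
  choose q hq using hq
  -- Writing `a = q I * g I`, a larger left ideal has a smaller right ideal `q I Γ`, so descending
  -- chains become ascending chains of right ideals, which stop.
  have hanti : StrictAnti fun I => Submodule.span Γᵐᵒᵖ {q I} := by
    intro I J hIJ
    have hgI : g I.1 ∈ J.1 := hIJ.le (by
      have h := Ideal.mem_span_singleton_self (α := Γ) (g I.1)
      rwa [← hg I.1] at h)
    rw [hg J.1] at hgI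
    obtain ⟨x, hx⟩ := Ideal.mem_span_singleton'.1 hgI
    have hg0 : g J.1 ≠ 0 := fun h => ha (by rw [← hq J, h, mul_zero])
    have hqJ : q J = q I * x := by
      apply mul_right_cancel₀ hg0
      rw [hq J, mul_assoc, hx, hq I]
    rw [lt_iff_le_and_ne]
    refine ⟨?_, fun h => ?_⟩
    · rw [Submodule.span_singleton_le_iff_mem, Submodule.mem_span_singleton]
      exact ⟨MulOpposite.op x, by simp [hqJ]⟩
    · have hm : q I ∈ Submodule.span Γᵐᵒᵖ {q J} := by
        have h' : Submodule.span Γᵐᵒᵖ {q J} = Submodule.span Γᵐᵒᵖ {q I} := h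
        rw [h']; exact Submodule.mem_span_singleton_self _
      obtain ⟨z, hz⟩ := Submodule.mem_span_singleton.1 hm
      have hqI0 : q I ≠ 0 := fun h => ha (by rw [← hq I, h, zero_mul])
      have hxz : x * z.unop = 1 := by
        apply mul_left_cancel₀ hqI0
        rw [mul_one, ← mul_assoc, ← hqJ]
        simpa using hz
      have hzx : z.unop * x = 1 := mul_eq_one_comm.1 hxz
      refine hIJ.not_ge ?_
      change J.1 ≤ I.1
      rw [hg J.1, Ideal.span_singleton_le_iff_mem, hg I.1, Ideal.mem_span_singleton']
      exact ⟨z.unop, by rw [← hx, ← mul_assoc, hzx, one_mul]⟩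
  exact hanti.wellFoundedLT

/-- A two-sided ideal of a bounded principal ideal domain is generated by a normal element. -/
theorem exists_normal_generator (hΓ : IsBoundedPID Γ) (J : Set Γ) (h0 : 0 ∈ J)
    (hadd : ∀ x ∈ J, ∀ y ∈ J, x + y ∈ J) (hl : ∀ x, ∀ y ∈ J, x * y ∈ J)
    (hr : ∀ x, ∀ y ∈ J, y * x ∈ J) :
    ∃ p, IsNormalElement p ∧ ((Ideal.span {p} : Ideal Γ) : Set Γ) = J := by
  have := hΓ.isDomain
  obtain ⟨b, hb⟩ := hΓ.left_principal ⟨⟨⟨J, fun ha hb => hadd _ ha _ hb⟩, h0⟩, fun x y hy => hl x y hy⟩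
  obtain ⟨a, ha⟩ := hΓ.right_principal
    ⟨⟨⟨J, fun ha hb => hadd _ ha _ hb⟩, h0⟩, fun x y hy => hr x.unop y hy⟩
  have hbJ : ∀ x, x ∈ J ↔ ∃ y, y * b = x := fun x => by
    rw [← Ideal.mem_span_singleton', ← hb]; rfl
  have haJ : ∀ x, x ∈ J ↔ ∃ y, a * y = x := fun x => by
    have : x ∈ J ↔ x ∈ Submodule.span Γᵐᵒᵖ {a} := by rw [← ha]; rfl
    rw [this, Submodule.mem_span_singleton]
    exact ⟨fun ⟨y, hy⟩ => ⟨y.unop, by simpa using hy⟩, fun ⟨y, hy⟩ => ⟨.op y, by simpa using hy⟩⟩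
  have haJ' : a ∈ J := (haJ a).2 ⟨1, mul_one a⟩
  have hbJ' : b ∈ J := (hbJ b).2 ⟨1, one_mul b⟩
  refine ⟨b, ⟨fun x => ?_, fun x => ?_⟩, by rw [← hb]; rfl⟩
  · obtain ⟨y, hy⟩ := (hbJ _).1 (hr x b hbJ')
    exact ⟨y, hy.symm⟩
  · obtain ⟨v, hv⟩ := (haJ b).1 hbJ'
    obtain ⟨u, hu⟩ := (hbJ a).1 haJ'
    by_cases h : a = 0
    · exact ⟨0, by rw [← hv, h]; simp⟩
    -- The two generators differ by a unit: `a = u b`, `b = a v` and `u a = a w` give `a w v = a`.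
    -- So `b` also generates on the right.
    · obtain ⟨w, hw⟩ := (haJ _).1 (hl u a haJ')
      have hwv : w * v = 1 := by
        apply mul_left_cancel₀ h
        rw [← mul_assoc, hw, mul_assoc, hv, hu, mul_one]
      have hvw : v * w = 1 := mul_eq_one_comm.1 hwv
      obtain ⟨y, hy⟩ := (haJ _).1 (hl x b hbJ')
      exact ⟨w * y, by rw [← hy, ← hv, ← mul_assoc, mul_assoc a, hvw, mul_one]⟩

/-- Over a bounded principal ideal domain which is not a division ring, a simple module is killed
by a nonzero normal element `p` such that `Γ / Γ p` is semisimple. -/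
theorem exists_normal_annihilator (hΓ : IsBoundedPID Γ) (hu : ∃ a : Γ, a ≠ 0 ∧ ¬ IsUnit a)
    (S : Type v) [AddCommGroup S] [Module Γ S] [IsSimpleModule Γ S] :
    ∃ p : Γ, IsNormalElement p ∧ p ≠ 0 ∧ (∀ s : S, p • s = 0) ∧
      IsSemisimpleModule Γ (Γ ⧸ Ideal.span {p}) := by
  classical
  have := hΓ.isDomain
  obtain ⟨p, hp, hpJ⟩ := hΓ.exists_normal_generator {x | ∀ s : S, x • s = 0} (by simp)
    (fun x hx y hy s => by rw [add_smul, hx, hy, add_zero])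
    (fun x y hy s => by rw [mul_smul, hy, smul_zero]) (fun x y hy s => by rw [mul_smul, hy])
  have hpJ' : ∀ x, x ∈ Ideal.span {p} ↔ ∀ s : S, x • s = 0 := fun x => by
    rw [← SetLike.mem_coe, hpJ]; rfl
  have hpS := (hpJ' p).1 (Ideal.mem_span_singleton_self _)
  have hp0 : p ≠ 0 := by
    rintro rfl
    have := IsSimpleModule.nontrivial Γ S
    obtain ⟨s, hs⟩ := exists_ne (0 : S)
    have hsurj := IsSimpleModule.toSpanSingleton_surjective Γ hs
    have hmax := IsSimpleModule.ker_toSpanSingleton_isMaximal Γ hs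
    -- If no nonzero element killed `s`, the zero ideal would be a maximal left ideal and `Γ` a
    -- division ring.
    have hbot : LinearMap.ker (LinearMap.toSpanSingleton Γ S s) ≠ ⊥ := by
      intro h
      rw [h] at hmax
      obtain ⟨a, ha0, ha⟩ := hu
      have h1 : ∀ b : Γ, b ≠ 0 → ∃ c, c * b = 1 := fun b hb => by
        have : Ideal.span {b} = ⊤ := hmax.1.2 _ (bot_lt_iff_ne_bot.2 (by simpa using hb))
        exact Ideal.mem_span_singleton'.1 (this ▸ Submodule.mem_top)
      obtain ⟨c, hc⟩ := h1 a ha0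
      exact ha (IsUnit.of_mul_eq_one c (mul_eq_one_comm.1 hc))
    -- A two-sided ideal that kills `s` kills `Γ s = S`.
    obtain ⟨J, hJ, hJI⟩ := hΓ.left_bounded _ hbot
    apply hJ
    rw [eq_bot_iff]
    intro x hx
    have : x ∈ Ideal.span {(0 : Γ)} := by
      rw [hpJ']
      intro t
      obtain ⟨y, rfl⟩ := hsurj t
      have := hJI _ (J.mul_mem_right x y hx)
      simpa [mul_smul] using this
    simpa using this
  refine ⟨p, hp, hp0, hpS, ?_⟩
  let f : (F : Finset S) → Γ →ₗ[Γ] (F → S) := fun F =>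
    LinearMap.pi fun s => LinearMap.toSpanSingleton Γ S s
  have hf : ∀ F x, x ∈ LinearMap.ker (f F) ↔ ∀ s ∈ F, x • s = 0 := fun F x => by
    simp [f, funext_iff]
  have hpf : ∀ F, p ∈ LinearMap.ker (f F) := fun F => (hf F p).2 fun s _ => hpS s
  have := hΓ.wellFoundedLT_Ici hp0
  -- A minimal annihilator of a finite subset `F` already kills all of `S`, so it is `Γp`, and `Γ /
  -- Γp` embeds in `S ^ F`.
  obtain ⟨_, ⟨F, rfl⟩, hF⟩ := WellFounded.has_min
    (wellFounded_lt (α := {I : Ideal Γ // p ∈ I}))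
    (Set.range fun F => (⟨LinearMap.ker (f F), hpf F⟩ : {I : Ideal Γ // p ∈ I})) ⟨_, ⟨∅, rfl⟩⟩
  have hker : LinearMap.ker (f F) = Ideal.span {p} := by
    apply le_antisymm
    · intro x hx
      rw [hpJ']
      intro s
      by_contra hxs
      apply hF _ ⟨insert s F, rfl⟩
      change LinearMap.ker (f (insert s F)) < LinearMap.ker (f F)
      rw [lt_iff_le_not_ge]
      refine ⟨fun y hy => ?_, fun h => hxs ?_⟩
      · rw [hf] at *
        exact fun t ht => hy t (Finset.mem_insert_of_mem ht)
      · exact (hf _ _).1 (h hx) s (Finset.mem_insert_self _ _)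
    · rw [Ideal.span_singleton_le_iff_mem]
      exact hpf F
  rw [← hker]
  exact IsSemisimpleModule.of_injective ((LinearMap.ker (f F)).liftQ (f F) le_rfl)
    (LinearMap.ker_eq_bot.1 (Submodule.ker_liftQ_eq_bot _ _ _ le_rfl))

end IsBoundedPID

/-! ### Injective hulls of simple modules -/

/-- An injective module `X` with an essential simple submodule `S`, such that `S` is the kernel of
the multiplication by a normal element `p`, which is surjective. -/
structure IsPrimaryHull {Γ : Type u} [Ring Γ] (p : Γ) {X : Type u} [AddCommGroup X] [Module Γ X]
    (S : Submodule Γ X) : Prop where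
  normal : IsNormalElement p
  simple : IsSimpleModule Γ S
  le_of_ne_bot : ∀ T : Submodule Γ X, T ≠ ⊥ → S ≤ T
  mem_iff : ∀ x, x ∈ S ↔ p • x = 0
  smul_surjective : ∀ x : X, ∃ y, p • y = x
  injective : Module.Injective Γ X

namespace IsBoundedPID

variable {Γ : Type u} [Ring Γ]

/-- Right multiplication by `a` embeds `Γ` in itself; extend `1 ↦ x` along it and evaluate the
extension at `1`. -/
theorem exists_smul_eq_of_injective (hΓ : IsBoundedPID Γ) {X : Type u} [AddCommGroup X]
    [Module Γ X] (hX : Module.Injective Γ X) {a : Γ} (ha : a ≠ 0) (x : X) : ∃ y, a • y = x := by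
  have := hΓ.isDomain
  obtain ⟨h, hh⟩ := hX.out (LinearMap.toSpanSingleton Γ Γ a)
    (fun b c hbc => mul_right_cancel₀ ha (by simpa using hbc)) (LinearMap.toSpanSingleton Γ X x)
  refine ⟨h 1, ?_⟩
  have := hh 1
  simp only [LinearMap.toSpanSingleton_apply, one_smul] at this
  rw [← map_smul, smul_eq_mul, mul_one, this]

/-- By Baer's criterion, only maps from principal left ideals `Γa` need extending, and such a map is
determined by the image of `a`. -/
theorem injective_of_exists_smul_eq (hΓ : IsBoundedPID Γ) {X : Type u} [AddCommGroup X]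
    [Module Γ X] (hX : ∀ a : Γ, a ≠ 0 → ∀ x : X, ∃ y, a • y = x) : Module.Injective Γ X := by
  apply Module.Baer.injective
  intro I g
  obtain ⟨a, rfl⟩ := hΓ.left_principal I
  by_cases ha : a = 0
  · subst ha
    refine ⟨0, fun x hx => ?_⟩
    have hx0 : (⟨x, hx⟩ : Ideal.span {(0 : Γ)}) = 0 := Subtype.ext (by simpa using hx)
    rw [hx0, map_zero, LinearMap.zero_apply]
  · obtain ⟨y, hy⟩ := hX a ha (g ⟨a, Ideal.mem_span_singleton_self a⟩)
    refine ⟨LinearMap.toSpanSingleton Γ X y, fun x hx => ?_⟩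
    obtain ⟨b, rfl⟩ := Ideal.mem_span_singleton'.1 hx
    rw [LinearMap.toSpanSingleton_apply, mul_smul, hy, ← map_smul]
    rfl

/-- Embed `S` in an injective `J` and divide by a submodule `C` maximal among those meeting `S`
trivially. Then `S` is essential in `J / C`, which remains divisible, hence injective. -/
theorem exists_isPrimaryHull (hΓ : IsBoundedPID Γ) {p : Γ} (hp : IsNormalElement p) (hp0 : p ≠ 0)
    (hss : IsSemisimpleModule Γ (Γ ⧸ Ideal.span {p})) (S : Type u) [AddCommGroup S] [Module Γ S]
    [IsSimpleModule Γ S] (hS : ∀ s : S, p • s = 0) :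
    ∃ (X : Type u) (_ : AddCommGroup X) (_ : Module Γ X) (T : Submodule Γ X),
      IsPrimaryHull p T ∧ Nonempty (T ≃ₗ[Γ] S) := by
  obtain ⟨⟨J, hJ, i, hi⟩⟩ := CategoryTheory.EnoughInjectives.presentation (ModuleCat.of Γ S)
  have hX0 : Module.Injective Γ J := Module.injective_module_of_injective_object Γ J
  have hinj : Function.Injective i.hom := (ModuleCat.mono_iff_injective i).1 hi
  let S₀ : Submodule Γ J := LinearMap.range i.hom
  have hS₀ : IsSimpleModule Γ S₀ := IsSimpleModule.congr (LinearEquiv.ofInjective i.hom hinj).symm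
  obtain ⟨C, hC⟩ := zorn_le_nonempty₀ {C : Submodule Γ J | Disjoint C S₀}
    (fun c hc hchain y hy => ⟨sSup c, by
      rw [Set.mem_ofPred_eq, hchain.directedOn.disjoint_sSup_left]
      exact fun b hb => hc hb, fun z hz => le_sSup hz⟩) ⊥ disjoint_bot_left
  obtain ⟨-, hC⟩ := hC
  have hCd : Disjoint C S₀ := hC.1
  let φ : S →ₗ[Γ] J ⧸ C := C.mkQ ∘ₗ i.hom
  have hφ : Function.Injective φ := by
    rw [← LinearMap.ker_eq_bot, LinearMap.ker_eq_bot']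
    intro s hs
    have h1 : i.hom s ∈ C := by simpa [φ] using hs
    have h2 : i.hom s = 0 := Submodule.disjoint_def.1 hCd _ h1 ⟨s, rfl⟩
    exact hinj (h2.trans (map_zero _).symm)
  let e := LinearEquiv.ofInjective φ hφ
  have hT : IsSimpleModule Γ (LinearMap.range φ) := IsSimpleModule.congr e.symm
  have hess : ∀ U : Submodule Γ (J ⧸ C), U ≠ ⊥ → LinearMap.range φ ≤ U := by
    intro U hU
    have hlt : ¬ Disjoint (U.comap C.mkQ) S₀ := by
      intro hd
      have hle : U.comap C.mkQ ≤ C :=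
        hC.2 hd (C.ker_mkQ.ge.trans (LinearMap.ker_le_comap _))
      apply hU
      rw [eq_bot_iff]
      intro x hx
      obtain ⟨y, rfl⟩ := C.mkQ_surjective x
      simpa using hle hx
    have hS₀' := (isSimpleModule_iff_isAtom.1 hS₀)
    have hle : S₀ ≤ U.comap C.mkQ := by
      rw [disjoint_comm] at hlt
      exact IsAtom.not_disjoint_iff_le hS₀' |>.1 hlt
    rintro _ ⟨s, rfl⟩
    exact hle ⟨s, rfl⟩
  have hdiv : ∀ a : Γ, a ≠ 0 → ∀ x : J ⧸ C, ∃ y, a • y = x := by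
    intro a ha x
    obtain ⟨x, rfl⟩ := C.mkQ_surjective x
    obtain ⟨y, rfl⟩ := hΓ.exists_smul_eq_of_injective hX0 ha x
    exact ⟨C.mkQ y, (map_smul _ _ _).symm⟩
  refine ⟨J ⧸ C, inferInstance, inferInstance, LinearMap.range φ,
    ⟨hp, hT, hess, ?_, hdiv p hp0, hΓ.injective_of_exists_smul_eq hdiv⟩, ⟨e.symm⟩⟩
  have hle : LinearMap.range φ ≤ hp.torsion (J ⧸ C) := by
    rintro _ ⟨s, rfl⟩
    rw [hp.mem_torsion, ← map_smul, hS, map_zero]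
  -- The kernel of `p` is semisimple, so `S` has a complement `Q` in it; a nonzero `Q` would contain
  -- the essential `S`.
  have hK : IsSemisimpleModule Γ (hp.torsion (J ⧸ C)) :=
    isSemisimpleModule_of_smul_eq_zero hss fun m => Subtype.ext m.2
  obtain ⟨Q, hQ⟩ := exists_isCompl ((LinearMap.range φ).comap (hp.torsion (J ⧸ C)).subtype)
  have hQ0 : Q = ⊥ := by
    by_contra hQ0
    have hQ1 : Q.map (hp.torsion (J ⧸ C)).subtype ≠ ⊥ := by
      refine fun h => hQ0 (Submodule.map_injective_of_injective (Submodule.injective_subtype _) ?_)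
      rw [h, Submodule.map_bot]
    have hQ2 := hess _ hQ1
    obtain ⟨s, hs⟩ := @exists_ne _ (IsSimpleModule.nontrivial Γ (LinearMap.range φ)) 0
    obtain ⟨y, hy, hys⟩ := hQ2 s.2
    refine hs (Subtype.ext ?_)
    have := Submodule.disjoint_def.1 hQ.disjoint y (by
      rw [Submodule.mem_comap, hys]; exact s.2) hy
    rw [← hys, this, map_zero]; rfl
  rw [hQ0] at hQ
  have htop := eq_top_of_isCompl_bot hQ
  intro x
  refine ⟨fun hx => hle hx, fun hx => ?_⟩
  have : (⟨x, hx⟩ : hp.torsion (J ⧸ C)) ∈ (⊤ : Submodule Γ (hp.torsion (J ⧸ C))) := trivial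
  rw [← htop] at this
  exact this

/-- Over a bounded principal ideal domain which is not a division ring, every simple module has a
primary hull. -/
theorem exists_isPrimaryHull_of_isSimpleModule (hΓ : IsBoundedPID Γ)
    (hu : ∃ a : Γ, a ≠ 0 ∧ ¬ IsUnit a) (S : Type u) [AddCommGroup S] [Module Γ S]
    [IsSimpleModule Γ S] :
    ∃ (p : Γ) (X : Type u) (_ : AddCommGroup X) (_ : Module Γ X) (T : Submodule Γ X),
      IsPrimaryHull p T ∧ Nonempty (T ≃ₗ[Γ] S) := by
  obtain ⟨p, hp, hp0, hpS, hss⟩ := hΓ.exists_normal_annihilator hu S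
  exact ⟨p, hΓ.exists_isPrimaryHull hp hp0 hss S hpS⟩

end IsBoundedPID

/-! ### The chain of kernels of `p ^ n` -/

namespace IsPrimaryHull

variable {Γ : Type u} [Ring Γ] {p : Γ} {X : Type u} [AddCommGroup X] [Module Γ X]
  {S : Submodule Γ X}

/-- The kernel of the multiplication by `p ^ n`. -/
abbrev layer (h : IsPrimaryHull p S) (n : ℕ) : Submodule Γ X := (h.normal.pow n).torsion X

theorem layer_zero (h : IsPrimaryHull p S) : h.layer 0 = ⊥ := by
  ext x; simp

theorem layer_one (h : IsPrimaryHull p S) : h.layer 1 = S := by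
  ext x; simp [h.mem_iff]

theorem exists_pow_smul_eq (h : IsPrimaryHull p S) (n : ℕ) (x : X) : ∃ y, p ^ n • y = x := by
  induction n with
  | zero => exact ⟨x, by simp⟩
  | succ n ih =>
    obtain ⟨y, rfl⟩ := ih
    obtain ⟨z, rfl⟩ := h.smul_surjective y
    exact ⟨z, by rw [pow_succ, mul_smul]⟩

theorem not_layer_succ_le (h : IsPrimaryHull p S) (n : ℕ) : ¬ h.layer (n + 1) ≤ h.layer n := by
  intro hle
  obtain ⟨s, hs⟩ := @exists_ne _ (@IsSimpleModule.nontrivial Γ _ S _ _ h.simple) 0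
  obtain ⟨y, hy⟩ := h.exists_pow_smul_eq n s
  have h1 : y ∈ h.layer (n + 1) := by
    rw [IsNormalElement.mem_torsion, pow_succ', mul_smul, hy]
    exact (h.mem_iff _).1 s.2
  have h2 := hle h1
  rw [IsNormalElement.mem_torsion, hy] at h2
  exact hs (Subtype.ext h2)

/-- A submodule of a primary hull which is killed by `p ^ (n + 1)` but not by `p ^ n` is the whole
kernel of `p ^ (n + 1)`. -/
theorem eq_layer (h : IsPrimaryHull p S) (n : ℕ) : ∀ T : Submodule Γ X,
    T ≤ h.layer (n + 1) → ¬ T ≤ h.layer n → T = h.layer (n + 1) := by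
  induction n with
  | zero =>
    intro T hT hT'
    refine le_antisymm hT ?_
    rw [h.layer_zero, le_bot_iff] at hT'
    rw [zero_add, h.layer_one]
    exact h.le_of_ne_bot T hT'
  | succ n ih =>
    intro T hT hT'
    -- Induction applies to `pT`, which must be all of `X_(n+1)`; then `T` is recovered from `pT` up
    -- to `ker p = S`, and `S ≤ T`.
    have h1 : h.normal.smulMap T ≤ h.layer (n + 1) := by
      rintro _ ⟨t, ht, rfl⟩
      have := hT ht
      rwa [IsNormalElement.mem_torsion, pow_succ, mul_smul] at this
    have h2 : ¬ h.normal.smulMap T ≤ h.layer n := by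
      refine fun hle => hT' fun t ht => ?_
      have := hle ⟨t, ht, rfl⟩
      rwa [IsNormalElement.mem_torsion, ← mul_smul, ← pow_succ] at this
    have h3 := ih _ h1 h2
    have hST : S ≤ T := h.le_of_ne_bot T (by rintro rfl; exact hT' bot_le)
    refine le_antisymm hT fun x hx => ?_
    have h4 : p • x ∈ h.normal.smulMap T := by
      rw [h3, IsNormalElement.mem_torsion, ← mul_smul, ← pow_succ]
      exact hx
    obtain ⟨t, ht, htx⟩ := h4
    have h5 : x - t ∈ S := by rw [h.mem_iff, smul_sub, htx, sub_self]
    simpa using T.add_mem (hST h5) ht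

theorem exists_eq_layer (h : IsPrimaryHull p S) (n : ℕ) (T : Submodule Γ X)
    (hT : T ≤ h.layer n) : ∃ m ≤ n, T = h.layer m := by
  induction n with
  | zero => exact ⟨0, le_rfl, le_antisymm hT (by rw [h.layer_zero]; exact bot_le)⟩
  | succ n ih =>
    by_cases hT' : T ≤ h.layer n
    · obtain ⟨m, hm, rfl⟩ := ih hT'
      exact ⟨m, by omega, rfl⟩
    · exact ⟨n + 1, le_rfl, h.eq_layer n T hT hT'⟩

theorem layer_mono (h : IsPrimaryHull p S) {m n : ℕ} (hmn : m ≤ n) : h.layer m ≤ h.layer n :=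
  h.normal.torsion_pow_mono hmn

theorem covBy (h : IsPrimaryHull p S) (n : ℕ) : h.layer n ⋖ h.layer (n + 1) := by
  refine ⟨lt_of_le_not_ge (h.layer_mono (by omega)) (h.not_layer_succ_le n), fun T h1 h2 => ?_⟩
  exact h2.ne (h.eq_layer n T h2.le h1.not_ge)

theorem length_layer (h : IsPrimaryHull p S) (n : ℕ) : Module.length Γ (h.layer n) = n := by
  induction n with
  | zero =>
    rw [h.layer_zero, Nat.cast_zero, Module.length_eq_zero_iff]
    infer_instance
  | succ n ih =>
    have hle := (h.covBy n).le
    have hs := (covBy_iff_quot_is_simple hle).1 (h.covBy n)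
    rw [Module.length_eq_add_of_exact (Submodule.inclusion hle)
      ((h.layer n).comap (h.layer (n + 1)).subtype).mkQ (Submodule.inclusion_injective hle)
      (Submodule.mkQ_surjective _), ih, Module.length_eq_one]
    · simp
    · rw [LinearMap.exact_iff, Submodule.ker_mkQ, Submodule.range_inclusion]

end IsPrimaryHull

/-! ### Indecomposable and hollow modules -/

/-- In the Fitting decomposition the kernel of `p ^ n` contains `x ≠ 0`, so the other summand `p ^ n
M` vanishes. -/
theorem IsIndecomposableModule.exists_pow_smul_eq_zero {Γ : Type u} [Ring Γ] {p : Γ}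
    (hp : IsNormalElement p) {M : Type v} [AddCommGroup M] [Module Γ M] [IsNoetherian Γ M]
    [IsArtinian Γ M] (hM : IsIndecomposableModule Γ M) {x : M} (hx : x ≠ 0) (hpx : p • x = 0) :
    ∃ n, ∀ m : M, p ^ n • m = 0 := by
  obtain ⟨n, hn, hc⟩ := hp.exists_isCompl (M := M)
  refine ⟨n, ?_⟩
  rcases hM.2 _ _ hc with h | h
  · exfalso
    apply hx
    have : x ∈ (hp.pow n).torsion M := hp.torsion_pow_mono hn (by simpa using hpx)
    rw [h] at this
    exact (Submodule.mem_bot Γ).1 this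
  · intro m
    have : p ^ n • m ∈ (hp.pow n).smulMap (⊤ : Submodule Γ M) := ⟨m, trivial, rfl⟩
    rw [h] at this
    exact (Submodule.mem_bot Γ).1 this

section Hollow

variable {Γ : Type u} [Ring Γ] {p : Γ} {H : Type v} [AddCommGroup H] [Module Γ H]

/-- In a hollow module killed by a power of `p`, where `Γ / Γ p` is semisimple, the submodule
`p H` is maximal. -/
theorem isCoatom_smulMap_top [IsNoetherian Γ H] [Nontrivial H] (hp : IsNormalElement p)
    (hss : IsSemisimpleModule Γ (Γ ⧸ Ideal.span {p}))
    (hollow : ∀ A B : Submodule Γ H, A ⊔ B = ⊤ → A = ⊤ ∨ B = ⊤) {n : ℕ}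
    (hn : ∀ x : H, p ^ n • x = 0) : IsCoatom (hp.smulMap (⊤ : Submodule Γ H)) := by
  obtain ⟨T, hT, -⟩ := (eq_top_or_exists_le_coatom (⊥ : Submodule Γ H)).resolve_left bot_ne_top
  have hpH : hp.smulMap (⊤ : Submodule Γ H) ≠ ⊤ := by
    intro h
    have : ∀ m, ∀ x : H, ∃ y, p ^ m • y = x := by
      intro m
      induction m with
      | zero => exact fun x => ⟨x, by simp⟩
      | succ m ih =>
        intro x
        obtain ⟨y, rfl⟩ := ih x
        have hy : y ∈ hp.smulMap (⊤ : Submodule Γ H) := by rw [h]; trivial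
        obtain ⟨z, -, rfl⟩ := hy
        exact ⟨z, by rw [pow_succ, mul_smul]⟩
    obtain ⟨x, hx⟩ := exists_ne (0 : H)
    obtain ⟨y, rfl⟩ := this n x
    exact hx (hn y)
  have hle : hp.smulMap (⊤ : Submodule Γ H) ≤ T := by
    by_contra hle
    have : hp.smulMap (⊤ : Submodule Γ H) ⊔ T = ⊤ := by
      rw [sup_comm]
      exact hT.2 _ (left_lt_sup.2 hle)
    rcases hollow _ _ this with h | h
    · exact hpH h
    · exact hT.1 h
  have hK : IsSemisimpleModule Γ (H ⧸ hp.smulMap (⊤ : Submodule Γ H)) := by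
    refine isSemisimpleModule_of_smul_eq_zero hss fun m => ?_
    obtain ⟨m, rfl⟩ := Submodule.mkQ_surjective _ m
    rw [← map_smul, Submodule.mkQ_apply, Submodule.Quotient.mk_eq_zero]
    exact ⟨m, trivial, rfl⟩
  -- In the semisimple module `H / pH` the image of the maximal submodule `T` has a complement `Q`.
  -- Hollowness makes `Q` everything, so `T = pH`.
  obtain ⟨Q, hQ⟩ := exists_isCompl (T.map (hp.smulMap (⊤ : Submodule Γ H)).mkQ)
  have hsup : T ⊔ Q.comap (hp.smulMap (⊤ : Submodule Γ H)).mkQ = ⊤ := by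
    rw [eq_top_iff]
    intro x _
    have hx : (hp.smulMap (⊤ : Submodule Γ H)).mkQ x ∈
      T.map (hp.smulMap (⊤ : Submodule Γ H)).mkQ ⊔ Q := by rw [hQ.sup_eq_top]; trivial
    obtain ⟨_, ⟨t, ht, rfl⟩, q, hq, hx⟩ := Submodule.mem_sup.1 hx
    refine Submodule.mem_sup.2 ⟨t, ht, x - t, ?_, by abel⟩
    rw [Submodule.mem_comap, map_sub, ← hx, add_sub_cancel_left]
    exact hq
  rcases hollow _ _ hsup with h | h
  · exact absurd h hT.1
  · have hQt : Q = ⊤ := by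
      rw [eq_top_iff]
      intro x _
      obtain ⟨x, rfl⟩ := Submodule.mkQ_surjective _ x
      have : x ∈ Q.comap (hp.smulMap (⊤ : Submodule Γ H)).mkQ := by rw [h]; trivial
      exact this
    rw [hQt] at hQ
    have hb := hQ.disjoint.eq_bot_of_le le_top
    have : T ≤ hp.smulMap ⊤ := by
      intro t ht
      rw [← Submodule.Quotient.mk_eq_zero, ← Submodule.mkQ_apply, ← Submodule.mem_bot Γ, ← hb]
      exact ⟨t, ht, rfl⟩
    rwa [le_antisymm hle this]

/-- The submodules of a hollow module `H` killed by a power of `p`, where `Γ / Γ p` is semisimple,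
are the `p ^ i H`. -/
theorem exists_eq_smulMap_pow [IsNoetherian Γ H] [Nontrivial H] (hp : IsNormalElement p)
    (hss : IsSemisimpleModule Γ (Γ ⧸ Ideal.span {p}))
    (hollow : ∀ A B : Submodule Γ H, A ⊔ B = ⊤ → A = ⊤ ∨ B = ⊤) {n : ℕ}
    (hn : ∀ x : H, p ^ n • x = 0) (T : Submodule Γ H) : ∃ i, T = (hp.pow i).smulMap ⊤ := by
  have hco := isCoatom_smulMap_top hp hss hollow hn
  by_contra! hT
  -- A submodule that is none of the `p ^ i H` lies in all of them, including `p ^ n H = 0`, a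
  -- contradiction. For the step, the preimage of `T` under `p ^ i` is either `H`, giving `T = p ^ i
  -- H`, or inside `pH`.
  have key : ∀ i, T ≤ (hp.pow i).smulMap ⊤ := by
    intro i
    induction i with
    | zero => exact fun t _ => ⟨t, trivial, by simp⟩
    | succ i ih =>
      have hle : (hp.pow i).smulComap T ≤ hp.smulMap ⊤ := by
        by_contra hle
        have hsup : hp.smulMap ⊤ ⊔ (hp.pow i).smulComap T = ⊤ := hco.2 _ (left_lt_sup.2 hle)
        rcases hollow _ _ hsup with h | h
        · exact hco.1 h
        · refine hT i (le_antisymm ih ?_)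
          rintro _ ⟨x, -, rfl⟩
          have : x ∈ (hp.pow i).smulComap T := h ▸ trivial
          exact this
      intro t ht
      obtain ⟨x, -, rfl⟩ := ih ht
      obtain ⟨y, -, rfl⟩ := hle ht
      exact ⟨y, trivial, by rw [pow_succ, mul_smul]⟩
  have hbot : (hp.pow n).smulMap (⊤ : Submodule Γ H) = ⊥ := by
    rw [eq_bot_iff]
    rintro _ ⟨x, -, rfl⟩
    exact hn x
  have := key n
  rw [hbot, le_bot_iff] at this
  exact hT n (this.trans hbot.symm)

/-- The submodules `p ^ i H` form a chain, so an atom lies below every nonzero one. -/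
theorem exists_simple_essential [IsNoetherian Γ H] [IsArtinian Γ H] [Nontrivial H]
    (hp : IsNormalElement p) (hss : IsSemisimpleModule Γ (Γ ⧸ Ideal.span {p}))
    (hollow : ∀ A B : Submodule Γ H, A ⊔ B = ⊤ → A = ⊤ ∨ B = ⊤) {n : ℕ}
    (hn : ∀ x : H, p ^ n • x = 0) :
    ∃ S : Submodule Γ H, IsSimpleModule Γ S ∧ ∀ T : Submodule Γ H, T ≠ ⊥ → S ≤ T := by
  obtain ⟨S, hS, -⟩ := (eq_bot_or_exists_atom_le (⊤ : Submodule Γ H)).resolve_left top_ne_bot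
  refine ⟨S, isSimpleModule_iff_isAtom.2 hS, fun T hT => ?_⟩
  obtain ⟨i, rfl⟩ := exists_eq_smulMap_pow hp hss hollow hn T
  obtain ⟨j, hj⟩ := exists_eq_smulMap_pow hp hss hollow hn S
  rcases le_total j i with h | h
  · have hle := hp.smulMap_pow_anti h (⊤ : Submodule Γ H)
    rw [← hj] at hle
    exact ((hS.le_iff.1 hle).resolve_left hT).ge
  · rw [hj]
    exact hp.smulMap_pow_anti h ⊤

end Hollow

/-! ### Classification of the indecomposable modules of finite length -/

namespace IsPrimaryHull

variable {Γ : Type u} [Ring Γ] {p : Γ} {X : Type u} [AddCommGroup X] [Module Γ X]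
  {S : Submodule Γ X}

/-- A module with an essential submodule isomorphic to `S` embeds into the primary hull of `S`. -/
theorem exists_injective (h : IsPrimaryHull p S) {M : Type u} [AddCommGroup M] [Module Γ M]
    {S' : Submodule Γ M} (hS' : ∀ T : Submodule Γ M, T ≠ ⊥ → S' ≤ T) (e : S' ≃ₗ[Γ] S) :
    ∃ g : M →ₗ[Γ] X, Function.Injective g := by
  obtain ⟨g, hg⟩ := h.injective.out S'.subtype (Submodule.injective_subtype _)
    (S.subtype ∘ₗ e.toLinearMap)
  refine ⟨g, ?_⟩
  rw [← LinearMap.ker_eq_bot]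
  by_contra hk
  have hle := hS' _ hk
  obtain ⟨s, hs⟩ := @exists_ne _ (@IsSimpleModule.nontrivial Γ _ S _ _ h.simple) 0
  have h1 : g (e.symm s) = 0 := hle (e.symm s).2
  have h2 := hg (e.symm s)
  rw [Submodule.subtype_apply, h1] at h2
  simp only [LinearMap.comp_apply, LinearEquiv.coe_coe, LinearEquiv.apply_symm_apply,
    Submodule.subtype_apply] at h2
  exact hs (Subtype.ext h2.symm)

theorem exists_layer_equiv_of_pow_smul_eq_zero (h : IsPrimaryHull p S) {M : Type u}
    [AddCommGroup M] [Module Γ M] {S' : Submodule Γ M}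
    (hS' : ∀ T : Submodule Γ M, T ≠ ⊥ → S' ≤ T) (e : S' ≃ₗ[Γ] S) {n : ℕ}
    (hn : ∀ m : M, p ^ n • m = 0) : ∃ j, Nonempty (M ≃ₗ[Γ] h.layer j) := by
  obtain ⟨g, hg⟩ := h.exists_injective hS' e
  obtain ⟨j, -, hj⟩ := h.exists_eq_layer n (LinearMap.range g) (by
    rintro _ ⟨m, rfl⟩
    rw [IsNormalElement.mem_torsion, ← map_smul, hn, map_zero])
  exact ⟨j, ⟨(LinearEquiv.ofInjective g hg).trans (LinearEquiv.ofEq _ _ hj)⟩⟩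

end IsPrimaryHull

/-- An indecomposable module of finite length over a bounded principal ideal domain which is not a
division ring is the kernel of the multiplication by `p ^ n` on a primary hull. -/
theorem IsBoundedPID.exists_layer_equiv {Γ : Type u} [Ring Γ] (hΓ : IsBoundedPID Γ)
    (hu : ∃ a : Γ, a ≠ 0 ∧ ¬ IsUnit a) {M : Type u} [AddCommGroup M] [Module Γ M]
    [IsNoetherian Γ M] [IsArtinian Γ M] (hM : IsIndecomposableModule Γ M) :
    ∃ (p : Γ) (X : Type u) (_ : AddCommGroup X) (_ : Module Γ X) (T : Submodule Γ X)
      (h : IsPrimaryHull p T) (n : ℕ), 1 ≤ n ∧ Nonempty (M ≃ₗ[Γ] h.layer n) := by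
  have := hM.1
  obtain ⟨S, hS, -⟩ := (eq_bot_or_exists_atom_le (⊤ : Submodule Γ M)).resolve_left top_ne_bot
  have hS' := isSimpleModule_iff_isAtom.2 hS
  obtain ⟨p, hp, hp0, hpS, hss⟩ := hΓ.exists_normal_annihilator hu S
  obtain ⟨x, hxS, hx⟩ := Submodule.exists_mem_ne_zero_of_ne_bot hS.1
  have hex := hM.exists_pow_smul_eq_zero hp hx (congrArg Subtype.val (hpS ⟨x, hxS⟩))
  classical
  obtain ⟨n, hn⟩ : ∃ n, Nat.find hex = n + 1 := by
    refine Nat.exists_eq_succ_of_ne_zero fun h0 => hx ?_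
    simpa [h0] using Nat.find_spec hex x
  have hkill : ∀ m : M, p ^ (n + 1) • m = 0 := hn ▸ Nat.find_spec hex
  have hnkill : ¬ ∀ m : M, p ^ n • m = 0 := Nat.find_min hex (by omega)
  -- `W` is hollow: if `W = A + B`, then `p ^ n A` or `p ^ n B` is nonzero, and minimality makes
  -- that summand `W`.
  obtain ⟨W, hW, hWmin⟩ := WellFounded.has_min (wellFounded_lt (α := Submodule Γ M))
    {W | (hp.pow n).smulMap W ≠ ⊥} ⟨⊤, fun h => hnkill fun m => by
      rw [← Submodule.mem_bot Γ, ← h]; exact ⟨m, trivial, rfl⟩⟩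
  have hWmin' : ∀ A ≤ W, (hp.pow n).smulMap A ≠ ⊥ → A = W := fun A hA hA' => by
    by_contra hne
    exact hWmin A hA' (lt_of_le_of_ne hA hne)
  have hollow : ∀ A B : Submodule Γ W, A ⊔ B = ⊤ → A = ⊤ ∨ B = ⊤ := by
    have htop : ∀ A : Submodule Γ W, A.map W.subtype = W → A = ⊤ := fun A hA => by
      apply Submodule.map_injective_of_injective W.injective_subtype
      rw [hA, Submodule.map_subtype_top]
    intro A B hAB
    have h1 : A.map W.subtype ⊔ B.map W.subtype = W := by
      rw [← Submodule.map_sup, hAB, Submodule.map_subtype_top]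
    have h2 := (hp.pow n).smulMap_sup (A.map W.subtype) (B.map W.subtype)
    rw [h1] at h2
    by_cases h3 : (hp.pow n).smulMap (A.map W.subtype) = ⊥
    · rw [h3, bot_sup_eq] at h2
      exact Or.inr (htop B (hWmin' _ (Submodule.map_subtype_le _ _) (h2 ▸ hW)))
    · exact Or.inl (htop A (hWmin' _ (Submodule.map_subtype_le _ _) h3))
  have hWbot : W ≠ ⊥ := by
    rintro rfl
    apply hW
    rw [eq_bot_iff]
    rintro _ ⟨t, ht, rfl⟩
    rw [(Submodule.mem_bot Γ).1 ht, smul_zero]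
    exact Submodule.zero_mem _
  have : Nontrivial W := Submodule.nontrivial_iff_ne_bot.2 hWbot
  have hWkill : ∀ w : W, p ^ (n + 1) • w = 0 := fun w => Subtype.ext (hkill w)
  obtain ⟨S₀, hS₀, hess⟩ := exists_simple_essential hp hss hollow hWkill
  have hpS₀ : ∀ s : S₀, p • s = 0 := by
    have hne : hp.torsion W ≠ ⊥ := by
      intro hbot
      have h1 : ∀ w : W, p • w = 0 → w = 0 := fun w hw => by
        rwa [← Submodule.mem_bot Γ, ← hbot]
      have h2 : ∀ k, ∀ w : W, p ^ k • w = 0 → w = 0 := by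
        intro k
        induction k with
        | zero => exact fun w hw => by simpa using hw
        | succ k ih => exact fun w hw => ih w (h1 _ (by rwa [← mul_smul, ← pow_succ']))
      obtain ⟨w, hw⟩ := exists_ne (0 : W)
      exact hw (h2 _ w (hWkill w))
    exact fun s => Subtype.ext (hess _ hne s.2)
  obtain ⟨X, _, _, T, h, ⟨e⟩⟩ := hΓ.exists_isPrimaryHull hp hp0 hss S₀ hpS₀
  obtain ⟨g, hg⟩ := h.exists_injective hess e.symm
  have hgr : LinearMap.range g = h.layer (n + 1) := by
    apply h.eq_layer
    · rintro _ ⟨w, rfl⟩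
      rw [IsNormalElement.mem_torsion, ← map_smul, hWkill, map_zero]
    · intro hle
      apply hW
      rw [eq_bot_iff]
      rintro _ ⟨w, hw, rfl⟩
      have h1 : p ^ n • g ⟨w, hw⟩ = 0 := hle ⟨⟨w, hw⟩, rfl⟩
      rw [← map_smul] at h1
      exact congrArg Subtype.val (hg (h1.trans (map_zero g).symm))
  -- The extension `G` of `g` to `M` still has image in `X_(n+1) = g(W)`, so it provides a
  -- retraction of `M` onto `W` with kernel `ker G`.
  obtain ⟨G, hG⟩ := h.injective.out W.subtype W.injective_subtype g
  have hGr : LinearMap.range G = h.layer (n + 1) := by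
    apply le_antisymm
    · rintro _ ⟨m, rfl⟩
      rw [IsNormalElement.mem_torsion, ← map_smul, hkill, map_zero]
    · rw [← hgr]
      rintro _ ⟨w, rfl⟩
      exact ⟨w, hG w⟩
  have hcompl : IsCompl W (LinearMap.ker G) := by
    refine ⟨?_, ?_⟩
    · rw [Submodule.disjoint_def]
      intro w hw hw'
      have h1 : g ⟨w, hw⟩ = 0 := (hG ⟨w, hw⟩).symm.trans hw'
      exact congrArg Subtype.val (hg (h1.trans (map_zero g).symm))
    · rw [codisjoint_iff, eq_top_iff]
      intro m _
      have h1 : G m ∈ LinearMap.range g := by rw [hgr, ← hGr]; exact ⟨m, rfl⟩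
      obtain ⟨w, hw⟩ := h1
      refine Submodule.mem_sup.2 ⟨w, w.2, m - w, ?_, by abel⟩
      rw [LinearMap.mem_ker, map_sub, ← hw, ← hG w, Submodule.subtype_apply, sub_self]
  have hker := (hM.2 _ _ hcompl).resolve_left hWbot
  exact ⟨p, X, _, _, T, h, n + 1, by omega,
    ⟨(LinearEquiv.ofInjective G (LinearMap.ker_eq_bot.1 hker)).trans (LinearEquiv.ofEq _ _ hGr)⟩⟩

/-! ### Length, endolength and socle -/

section Generalities

/-- Since `σ` is surjective, both modules have the same lattice of submodules; `σ` need not be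
injective, as for restriction of endomorphisms to the socle. -/
theorem Module.length_eq_of_bijective_semilinear {R R' M M' : Type*} [Ring R] [Ring R']
    [AddCommGroup M] [AddCommGroup M'] [Module R M] [Module R' M'] {σ : R →+* R'}
    [RingHomSurjective σ] (f : M →ₛₗ[σ] M') (hf : Function.Bijective f) :
    Module.length R M = Module.length R' M' := by
  apply WithBot.coe_injective
  rw [Module.coe_length, Module.coe_length]
  exact Order.krullDim_eq_of_orderIso (Submodule.orderIsoMapComapOfBijective f hf)

/-- The length of a module in terms of the kernel of a nilpotent endomorphism whose powers have
images containing this kernel. -/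
theorem Module.length_eq_mul_length_ker {R M : Type*} [Ring R] [AddCommGroup M] [Module R M]
    (f : M →ₗ[R] M) {n : ℕ} (hn : ∀ x, (f ^ n) x = 0)
    (hf : ∀ i < n, ∀ x, f x = 0 → ∃ y, (f ^ i) y = x) :
    Module.length R M = n * Module.length R (LinearMap.ker f) := by
  have key : ∀ i ≤ n, Module.length R (LinearMap.ker (f ^ i)) =
      i * Module.length R (LinearMap.ker f) := by
    intro i
    induction i with
    | zero =>
      intro _
      rw [Nat.cast_zero, zero_mul, Module.length_eq_zero_iff, Submodule.subsingleton_iff_eq_bot]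
      exact LinearMap.ker_id
    | succ i ih =>
      intro hi
      have hle : LinearMap.ker (f ^ i) ≤ LinearMap.ker (f ^ (i + 1)) := fun x hx => by
        rw [LinearMap.mem_ker, pow_succ', Module.End.mul_apply, LinearMap.mem_ker.1 hx, map_zero]
      have hmap : ∀ x ∈ LinearMap.ker (f ^ (i + 1)), (f ^ i) x ∈ LinearMap.ker f := fun x hx => by
        rwa [LinearMap.mem_ker, ← Module.End.mul_apply, ← pow_succ']
      -- The sequence `0 → ker (f ^ i) → ker (f ^ (i + 1)) → ker f → 0`, with second map `f ^ i`, is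
      -- exact on the right by `hf`.
      rw [Module.length_eq_add_of_exact (Submodule.inclusion hle) ((f ^ i).restrict hmap)
        (Submodule.inclusion_injective hle), ih (by omega)]
      · push_cast
        ring
      · rintro ⟨x, hx⟩
        obtain ⟨y, rfl⟩ := hf i (by omega) x hx
        exact ⟨⟨y, by rwa [LinearMap.mem_ker, pow_succ', Module.End.mul_apply]⟩, rfl⟩
      · rintro ⟨x, hx⟩
        constructor
        · intro h
          exact ⟨⟨x, congrArg Subtype.val h⟩, rfl⟩
        · rintro ⟨y, hy⟩
          have : x = y := (congrArg Subtype.val hy).symm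
          subst this
          exact Subtype.ext y.2
  have htop : LinearMap.ker (f ^ n) = ⊤ := by
    rw [eq_top_iff]
    exact fun x _ => hn x
  rw [← key n le_rfl, htop, Module.length_top]

variable {R : Type u} [Ring R] {M N : Type v} [AddCommGroup M] [Module R M] [AddCommGroup N]
  [Module R N]

theorem isNoetherian_and_isArtinian_of_length_eq {n : ℕ} (h : Module.length R M = n) :
    IsNoetherian R M ∧ IsArtinian R M := by
  rw [← isFiniteLength_iff_isNoetherian_isArtinian, ← Module.length_ne_top_iff, h]
  exact ENat.natCast_ne_top n

theorem endolength_congr (e : M ≃ₗ[R] N) : endolength R M = endolength R N := by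
  let σ : Module.End R M ≃+* Module.End R N := e.conjRingEquiv
  have : RingHomSurjective (σ : Module.End R M →+* Module.End R N) := ⟨σ.surjective⟩
  let f : M →ₛₗ[(σ : Module.End R M →+* Module.End R N)] N :=
    { toFun := e
      map_add' := map_add e
      map_smul' := fun φ m => by simp [σ] }
  exact Module.length_eq_of_bijective_semilinear f e.bijective

theorem moduleSocle_map_le (e : M ≃ₗ[R] N) :
    (moduleSocle R M).map (e : M →ₗ[R] N) ≤ moduleSocle R N := by
  rw [Submodule.map_le_iff_le_comap]
  refine sSup_le fun A hA => ?_
  rw [← Submodule.map_le_iff_le_comap]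
  have hA' : IsSimpleModule R A := hA
  exact le_sSup (IsSimpleModule.congr (e.submoduleMap A).symm)

theorem nonempty_moduleSocle_equiv (e : M ≃ₗ[R] N) :
    Nonempty (moduleSocle R M ≃ₗ[R] moduleSocle R N) := by
  have h : (moduleSocle R M).map (e : M →ₗ[R] N) = moduleSocle R N := by
    refine le_antisymm (moduleSocle_map_le e) fun x hx => ?_
    exact ⟨e.symm x, moduleSocle_map_le e.symm ⟨x, hx, rfl⟩, e.apply_symm_apply x⟩
  exact ⟨(e.submoduleMap _).trans (LinearEquiv.ofEq _ _ h)⟩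

theorem moduleSocle_eq_of_essential {S : Submodule R M} [IsSimpleModule R S]
    (hS : ∀ T : Submodule R M, T ≠ ⊥ → S ≤ T) : moduleSocle R M = S := by
  refine le_antisymm (sSup_le fun T hT => ?_) (le_sSup ‹IsSimpleModule R S›)
  have hT' := isSimpleModule_iff_isAtom.1 hT
  have hS' := isSimpleModule_iff_isAtom.1 ‹IsSimpleModule R S›
  exact ((hT'.le_iff.1 (hS T hT'.1)).resolve_left hS'.1).ge

theorem isIndecomposableModule_of_essential {S : Submodule R M} [IsSimpleModule R S]
    (hS : ∀ T : Submodule R M, T ≠ ⊥ → S ≤ T) : IsIndecomposableModule R M := by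
  have hS' := isSimpleModule_iff_isAtom.1 ‹IsSimpleModule R S›
  refine ⟨?_, fun A B h => ?_⟩
  · have := IsSimpleModule.nontrivial R S
    exact S.subtype_injective.nontrivial
  · by_contra! hAB
    exact hS'.1 (le_bot_iff.1 (h.disjoint (hS A hAB.1) (hS B hAB.2)))

end Generalities

/-! ### Finite dimension over the base field -/

section FiniteDimensional

/-- Multiplication by `p` is `k`-linear and maps `ker p ^ (i + 1)` into `ker p ^ i` with kernel
inside `S`, so finiteness climbs the filtration. -/
theorem Module.Finite.of_pow_smul_eq_zero {k : Type*} [Field k] {Γ : Type*} [Ring Γ] [Algebra k Γ]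
    {M : Type*} [AddCommGroup M] [Module Γ M] [Module k M] [IsScalarTower k Γ M]
    {p : Γ} {n : ℕ} (hn : ∀ m : M, p ^ n • m = 0)
    {S : Submodule Γ M} (hS : ∀ x, x ∈ S ↔ p • x = 0) [Module.Finite k S] :
    Module.Finite k M := by
  let f : ℕ → M →ₗ[k] M := fun i =>
    { toFun := fun x => p ^ i • x
      map_add' := smul_add _
      map_smul' := fun c x => smul_comm _ _ _ }
  have hf : ∀ i x, f i x = p ^ i • x := fun _ _ => rfl
  have hker : (LinearMap.ker (f 1)).FG := by
    have : LinearMap.ker (f 1) = LinearMap.range (S.subtype.restrictScalars k) := by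
      ext x
      rw [LinearMap.mem_ker, hf, pow_one]
      exact ⟨fun hx => ⟨⟨x, (hS x).2 hx⟩, rfl⟩, by rintro ⟨y, rfl⟩; exact (hS _).1 y.2⟩
    rw [this]
    exact Module.Finite.iff_fg.1 inferInstance
  have key : ∀ i, (LinearMap.ker (f i)).FG := by
    intro i
    induction i with
    | zero =>
      have : LinearMap.ker (f 0) = ⊥ := by
        rw [LinearMap.ker_eq_bot']
        intro x hx
        simpa [hf] using hx
      rw [this]
      exact Submodule.fg_bot
    | succ i ih =>
      refine Submodule.fg_of_fg_map_of_fg_inf_ker (f 1) (ih.of_le ?_) (hker.of_le inf_le_right)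
      rintro _ ⟨x, hx, rfl⟩
      rw [LinearMap.mem_ker, hf, hf, pow_one, ← mul_smul, ← pow_succ]
      exact hx
  refine ⟨?_⟩
  have htop : LinearMap.ker (f n) = ⊤ := by
    rw [eq_top_iff]
    exact fun x _ => hn x
  rw [← htop]
  exact key n

variable {k : Type v} [Field k] {Γ : Type u} [Ring Γ] [Algebra k Γ] {M N : Type u}
  [AddCommGroup M] [Module Γ M] [AddCommGroup N] [Module Γ N]

theorem finite_restrictScalars_of_injective (f : M →ₗ[Γ] N) (hf : Function.Injective f)
    (hN : Module.Finite k (RestrictScalars k Γ N)) :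
    Module.Finite k (RestrictScalars k Γ M) := by
  let _ := Module.restrictScalars k Γ M
  let _ := Module.restrictScalars k Γ N
  have := IsScalarTower.restrictScalars k Γ M
  have := IsScalarTower.restrictScalars k Γ N
  have : Module.Finite k N := hN
  exact Module.Finite.of_injective (f.restrictScalars k) hf

theorem isNoetherian_and_isArtinian_of_finite (hM : Module.Finite k (RestrictScalars k Γ M)) :
    IsNoetherian Γ M ∧ IsArtinian Γ M := by
  let _ := Module.restrictScalars k Γ M
  have := IsScalarTower.restrictScalars k Γ M
  have : Module.Finite k M := hM
  exact ⟨isNoetherian_of_tower k inferInstance, isArtinian_of_tower k inferInstance⟩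

theorem finite_restrictScalars_of_pow_smul_eq_zero {p : Γ} {n : ℕ} (hn : ∀ m : M, p ^ n • m = 0)
    {S : Submodule Γ M} (hS : ∀ x, x ∈ S ↔ p • x = 0)
    (hfin : Module.Finite k (RestrictScalars k Γ S)) :
    Module.Finite k (RestrictScalars k Γ M) := by
  let _ := Module.restrictScalars k Γ M
  have := IsScalarTower.restrictScalars k Γ M
  have : Module.Finite k S := hfin
  exact Module.Finite.of_pow_smul_eq_zero (M := M) hn hS

end FiniteDimensional

/-! ### Socle and endolength of the kernel of `p ^ n` -/

namespace IsPrimaryHull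

variable {Γ : Type u} [Ring Γ] {p : Γ} {X : Type u} [AddCommGroup X] [Module Γ X]
  {S : Submodule Γ X}

/-- The simple submodule `S` as a submodule of the kernel of `p ^ n`. -/
abbrev layerSocle (h : IsPrimaryHull p S) (n : ℕ) : Submodule Γ (h.layer n) :=
  S.comap (h.layer n).subtype

variable (h : IsPrimaryHull p S) {n : ℕ}

theorem mem_layerSocle (x : h.layer n) : x ∈ h.layerSocle n ↔ p • x = 0 := by
  rw [Submodule.mem_comap, h.mem_iff, Submodule.subtype_apply, Subtype.ext_iff]
  rfl

theorem le_layer (hn : 1 ≤ n) : S ≤ h.layer n := h.layer_one.ge.trans (h.layer_mono hn)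

/-- The simple submodule of the kernel of `p ^ n` is isomorphic to `S`. -/
noncomputable def layerSocleEquiv (hn : 1 ≤ n) : h.layerSocle n ≃ₗ[Γ] S :=
  Submodule.comapSubtypeEquivOfLe (h.le_layer hn)

theorem isSimpleModule_layerSocle (hn : 1 ≤ n) : IsSimpleModule Γ (h.layerSocle n) :=
  have := h.simple
  IsSimpleModule.congr (h.layerSocleEquiv hn)

theorem layerSocle_le (T : Submodule Γ (h.layer n)) (hT : T ≠ ⊥) : h.layerSocle n ≤ T := by
  intro x hx
  have h1 : T.map (h.layer n).subtype ≠ ⊥ := by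
    refine fun h1 => hT (Submodule.map_injective_of_injective (Submodule.injective_subtype _) ?_)
    rw [h1, Submodule.map_bot]
  obtain ⟨y, hy, hyx⟩ := h.le_of_ne_bot _ h1 hx
  rwa [← Submodule.injective_subtype _ hyx]

theorem moduleSocle_layer (hn : 1 ≤ n) : moduleSocle Γ (h.layer n) = h.layerSocle n :=
  have := h.isSimpleModule_layerSocle hn
  moduleSocle_eq_of_essential h.layerSocle_le

theorem isIndecomposableModule_layer (hn : 1 ≤ n) : IsIndecomposableModule Γ (h.layer n) :=
  have := h.isSimpleModule_layerSocle hn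
  isIndecomposableModule_of_essential h.layerSocle_le

theorem pow_smul_layer (x : h.layer n) : p ^ n • x = 0 := Subtype.ext x.2

/-- Every endomorphism of the socle of the kernel of `p ^ n` extends. -/
theorem exists_extension (f : Module.End Γ (h.layerSocle n)) :
    ∃ g : Module.End Γ (h.layer n), ∀ x : h.layerSocle n, g x = f x := by
  obtain ⟨g, hg⟩ := h.injective.out (h.layerSocle n).subtype (Submodule.injective_subtype _)
    ((h.layer n).subtype ∘ₗ (h.layerSocle n).subtype ∘ₗ f)
  refine ⟨g.codRestrict (h.layer n) fun x => ?_, fun x => Subtype.ext (hg x)⟩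
  rw [IsNormalElement.mem_torsion, ← map_smul, h.pow_smul_layer, map_zero]

theorem endolength_layer (n : ℕ) :
    endolength Γ (h.layer n) = n * endolength Γ (h.layerSocle n) := by
  -- Multiplication by `p` is linear over the endomorphism ring, whatever its behaviour over `Γ`.
  let f : h.layer n →ₗ[Module.End Γ (h.layer n)] h.layer n :=
    { toFun := fun x => p • x
      map_add' := smul_add p
      map_smul' := fun φ x => (map_smul φ p x).symm }
  have hf : ∀ i x, (f ^ i) x = p ^ i • x := by
    intro i
    induction i with
    | zero => intro x; simp
    | succ i ih =>
      intro x
      rw [pow_succ', Module.End.mul_apply, ih, pow_succ', mul_smul]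
      rfl
  have hker : ∀ x, f x = 0 ↔ x ∈ h.layerSocle n := fun x => (h.mem_layerSocle x).symm
  have hlen := Module.length_eq_mul_length_ker f (n := n)
    (fun x => by rw [hf, h.pow_smul_layer]) (fun i hi x hx => by
      -- Division by `p ^ i` takes place in `X`; as `px = 0`, the quotient lies in `X_(i+1)`, inside
      -- `X_n` because `i < n`.
      obtain ⟨y, hy⟩ := h.exists_pow_smul_eq i x
      have hy' : y ∈ h.layer (i + 1) := by
        rw [IsNormalElement.mem_torsion, pow_succ', mul_smul, hy]
        exact congrArg Subtype.val hx
      exact ⟨⟨y, h.layer_mono hi hy'⟩, by rw [hf]; exact Subtype.ext hy⟩)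
  rw [endolength, hlen, endolength]
  congr 1
  have hres : ∀ φ : Module.End Γ (h.layer n), ∀ x ∈ h.layerSocle n, φ x ∈ h.layerSocle n := by
    intro φ x hx
    rw [mem_layerSocle] at *
    rw [← map_smul, hx, map_zero]
  let σ : Module.End Γ (h.layer n) →+* Module.End Γ (h.layerSocle n) :=
    { toFun := fun φ => φ.restrict (hres φ)
      map_one' := rfl
      map_mul' := fun _ _ => rfl
      map_zero' := rfl
      map_add' := fun _ _ => rfl }
  -- Surjectivity of restriction identifies the length of the socle over `End X_n` with its
  -- endolength.
  have : RingHomSurjective σ := ⟨fun φ => by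
    obtain ⟨g, hg⟩ := h.exists_extension φ
    exact ⟨g, LinearMap.ext fun x => Subtype.ext (hg x)⟩⟩
  let F : LinearMap.ker f →ₛₗ[σ] h.layerSocle n :=
    { toFun := fun x => ⟨x.1, (hker x.1).1 x.2⟩
      map_add' := fun _ _ => rfl
      map_smul' := fun _ _ => rfl }
  refine Module.length_eq_of_bijective_semilinear F ⟨fun x y hxy => ?_, fun x => ?_⟩
  · have hxy' := congrArg Subtype.val hxy
    exact Subtype.ext hxy'
  · exact ⟨⟨x.1, (hker x.1).2 x.2⟩, rfl⟩

end IsPrimaryHull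

/-! ### The case of a division ring -/

section DivisionRing

variable {Γ : Type u} [Ring Γ] {M N : Type v} [AddCommGroup M] [Module Γ M] [AddCommGroup N]
  [Module Γ N]

theorem IsSimpleModule.self_of_isUnit [Nontrivial Γ] (hu : ∀ a : Γ, a ≠ 0 → IsUnit a) :
    IsSimpleModule Γ Γ := by
  rw [isSimpleModule_iff_toSpanSingleton_surjective]
  refine ⟨inferInstance, fun a ha b => ?_⟩
  obtain ⟨u, rfl⟩ := hu a ha
  exact ⟨b * ↑u⁻¹, by simp⟩

theorem IsIndecomposableModule.isSimpleModule [IsSimpleModule Γ Γ]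
    (hM : IsIndecomposableModule Γ M) : IsSimpleModule Γ M := by
  have : IsSemisimpleModule Γ M := isSemisimpleModule_of_smul_eq_zero (p := (0 : Γ))
    inferInstance fun m => zero_smul Γ m
  have := hM.1
  rw [isSimpleModule_iff]
  refine { eq_bot_or_eq_top := fun A => ?_ }
  obtain ⟨B, hB⟩ := exists_isCompl A
  refine (hM.2 A B hB).imp id fun h => ?_
  rw [h] at hB
  exact eq_top_of_isCompl_bot hB

theorem IsSimpleModule.nonempty_equiv_self [IsSimpleModule Γ Γ] [IsSimpleModule Γ M] :
    Nonempty (Γ ≃ₗ[Γ] M) := by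
  have := IsSimpleModule.nontrivial Γ M
  obtain ⟨m, hm⟩ := exists_ne (0 : M)
  have hne : LinearMap.toSpanSingleton Γ M m ≠ 0 := fun h => hm (by simpa using congr($h 1))
  exact ⟨LinearEquiv.ofBijective _ (LinearMap.bijective_of_ne_zero hne)⟩

theorem moduleSocle_eq_top [IsSimpleModule Γ M] : moduleSocle Γ M = ⊤ := by
  have : IsSimpleModule Γ (⊤ : Submodule Γ M) := IsSimpleModule.congr Submodule.topEquiv
  rw [eq_top_iff]
  exact le_sSup this

end DivisionRing

/-! ### The assertions for all bounded principal ideal domains -/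

namespace IsBoundedPID

variable {Γ : Type u} [Ring Γ]

theorem isSimpleModule_self (hΓ : IsBoundedPID Γ) (hu : ¬ ∃ a : Γ, a ≠ 0 ∧ ¬ IsUnit a) :
    IsSimpleModule Γ Γ := by
  have := hΓ.isDomain
  push Not at hu
  exact IsSimpleModule.self_of_isUnit hu

/-- An indecomposable module of length `n` over a bounded principal ideal domain which is not a
division ring is the kernel of the multiplication by `p ^ n` on a primary hull of its socle. -/
theorem exists_layer_length_equiv (hΓ : IsBoundedPID Γ) (hu : ∃ a : Γ, a ≠ 0 ∧ ¬ IsUnit a)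
    {M : Type u} [AddCommGroup M] [Module Γ M] {n : ℕ} (hM : IsIndecomposableModule Γ M)
    (hn : Module.length Γ M = n) :
    ∃ (p : Γ) (X : Type u) (_ : AddCommGroup X) (_ : Module Γ X) (T : Submodule Γ X)
      (h : IsPrimaryHull p T), 1 ≤ n ∧ Nonempty (M ≃ₗ[Γ] h.layer n) := by
  obtain ⟨_, _⟩ := isNoetherian_and_isArtinian_of_length_eq hn
  obtain ⟨p, X, _, _, T, h, m, hm, ⟨e⟩⟩ := hΓ.exists_layer_equiv hu hM
  have hmn : m = n := by
    rw [e.length_eq, h.length_layer] at hn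
    exact_mod_cast hn
  subst hmn
  exact ⟨p, X, _, _, T, h, hm, ⟨e⟩⟩

theorem isSimpleModule_moduleSocle (hΓ : IsBoundedPID Γ) {M : Type u} [AddCommGroup M]
    [Module Γ M] {n : ℕ} (hM : IsIndecomposableModule Γ M) (hn : Module.length Γ M = n) :
    IsSimpleModule Γ (moduleSocle Γ M) := by
  by_cases hu : ∃ a : Γ, a ≠ 0 ∧ ¬ IsUnit a
  · obtain ⟨p, X, _, _, T, h, hn1, ⟨e⟩⟩ := hΓ.exists_layer_length_equiv hu hM hn
    obtain ⟨e'⟩ := nonempty_moduleSocle_equiv e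
    rw [h.moduleSocle_layer hn1] at e'
    have := h.isSimpleModule_layerSocle hn1
    exact IsSimpleModule.congr e'
  · have := hΓ.isSimpleModule_self hu
    have := hM.isSimpleModule
    rw [moduleSocle_eq_top]
    exact IsSimpleModule.congr Submodule.topEquiv

theorem endolength_eq (hΓ : IsBoundedPID Γ) {M : Type u} [AddCommGroup M] [Module Γ M] {n : ℕ}
    (hM : IsIndecomposableModule Γ M) (hn : Module.length Γ M = n) :
    endolength Γ M = n * endolength Γ (moduleSocle Γ M) := by
  by_cases hu : ∃ a : Γ, a ≠ 0 ∧ ¬ IsUnit a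
  · obtain ⟨p, X, _, _, T, h, hn1, ⟨e⟩⟩ := hΓ.exists_layer_length_equiv hu hM hn
    obtain ⟨e'⟩ := nonempty_moduleSocle_equiv e
    rw [endolength_congr e, endolength_congr e', h.moduleSocle_layer hn1, h.endolength_layer]
  · have := hΓ.isSimpleModule_self hu
    have := hM.isSimpleModule
    rw [Module.length_eq_one] at hn
    rw [← hn, one_mul, moduleSocle_eq_top]
    exact endolength_congr Submodule.topEquiv.symm

/-- The element `p` attached to `M` kills the isomorphic socle of `N`, so a power of `p` kills `N`.
Hence `N` is a layer of the same hull as `M`, and the length tells which. -/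
theorem nonempty_equiv_of_moduleSocle_equiv (hΓ : IsBoundedPID Γ) {M N : Type u} [AddCommGroup M]
    [Module Γ M] [AddCommGroup N] [Module Γ N] {n : ℕ} (hM : IsIndecomposableModule Γ M)
    (hnM : Module.length Γ M = n) (hN : IsIndecomposableModule Γ N)
    (hnN : Module.length Γ N = n) (e : moduleSocle Γ M ≃ₗ[Γ] moduleSocle Γ N) :
    Nonempty (M ≃ₗ[Γ] N) := by
  by_cases hu : ∃ a : Γ, a ≠ 0 ∧ ¬ IsUnit a
  · obtain ⟨p, X, _, _, T, h, hn1, ⟨eM⟩⟩ := hΓ.exists_layer_length_equiv hu hM hnM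
    obtain ⟨q, Y, _, _, U, h', -, ⟨eN⟩⟩ := hΓ.exists_layer_length_equiv hu hN hnN
    obtain ⟨eM'⟩ := nonempty_moduleSocle_equiv eM
    obtain ⟨eN'⟩ := nonempty_moduleSocle_equiv eN
    rw [h.moduleSocle_layer hn1] at eM'
    rw [h'.moduleSocle_layer hn1] at eN'
    have f : h'.layerSocle n ≃ₗ[Γ] T :=
      eN'.symm.trans (e.symm.trans (eM'.trans (h.layerSocleEquiv hn1)))
    obtain ⟨_, _⟩ := isNoetherian_and_isArtinian_of_length_eq (h'.length_layer n)
    obtain ⟨t, ht⟩ := @exists_ne _ (@IsSimpleModule.nontrivial Γ _ T _ _ h.simple) 0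
    obtain ⟨m, hm⟩ := (h'.isIndecomposableModule_layer hn1).exists_pow_smul_eq_zero h.normal
      (x := (f.symm t : h'.layer n)) (fun h0 => ht (by simpa using h0)) (by
        rw [← Submodule.coe_smul, ← map_smul]
        have : p • t = 0 := Subtype.ext ((h.mem_iff _).1 t.2)
        rw [this, map_zero, Submodule.coe_zero])
    obtain ⟨j, ⟨g⟩⟩ := h.exists_layer_equiv_of_pow_smul_eq_zero h'.layerSocle_le f hm
    have hj : n = j := by
      have := g.length_eq
      rw [h.length_layer, h'.length_layer] at this
      exact_mod_cast this
    subst hj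
    exact ⟨eM.trans (g.symm.trans eN.symm)⟩
  · have := hΓ.isSimpleModule_self hu
    have := hM.isSimpleModule
    have := hN.isSimpleModule
    obtain ⟨eM⟩ := IsSimpleModule.nonempty_equiv_self (Γ := Γ) (M := M)
    obtain ⟨eN⟩ := IsSimpleModule.nonempty_equiv_self (Γ := Γ) (M := N)
    exact ⟨eM.symm.trans eN⟩

theorem exists_indecomposable (hΓ : IsBoundedPID Γ) (hu : ∃ a : Γ, a ≠ 0 ∧ ¬ IsUnit a)
    (S : Type u) [AddCommGroup S] [Module Γ S] [IsSimpleModule Γ S] {n : ℕ} (hn : 1 ≤ n) :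
    ∃ (M : Type u) (_ : AddCommGroup M) (_ : Module Γ M),
      IsIndecomposableModule Γ M ∧ Module.length Γ M = n ∧
        Nonempty (moduleSocle Γ M ≃ₗ[Γ] S) := by
  obtain ⟨p, X, _, _, T, h, ⟨e⟩⟩ := hΓ.exists_isPrimaryHull_of_isSimpleModule hu S
  refine ⟨h.layer n, inferInstance, inferInstance, h.isIndecomposableModule_layer hn,
    h.length_layer n, ?_⟩
  rw [h.moduleSocle_layer hn]
  exact ⟨(h.layerSocleEquiv hn).trans e⟩

variable {k : Type v} [Field k] [Algebra k Γ]

theorem finite_of_finite_moduleSocle (hΓ : IsBoundedPID Γ) (hu : ∃ a : Γ, a ≠ 0 ∧ ¬ IsUnit a)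
    {M : Type u} [AddCommGroup M] [Module Γ M] {n : ℕ} (hM : IsIndecomposableModule Γ M)
    (hn : Module.length Γ M = n)
    (hfin : Module.Finite k (RestrictScalars k Γ (moduleSocle Γ M))) :
    Module.Finite k (RestrictScalars k Γ M) := by
  obtain ⟨p, X, _, _, T, h, hn1, ⟨e⟩⟩ := hΓ.exists_layer_length_equiv hu hM hn
  obtain ⟨e'⟩ := nonempty_moduleSocle_equiv e
  rw [h.moduleSocle_layer hn1] at e'
  exact finite_restrictScalars_of_injective e.toLinearMap e.injective
    (finite_restrictScalars_of_pow_smul_eq_zero h.pow_smul_layer h.mem_layerSocle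
      (finite_restrictScalars_of_injective e'.symm.toLinearMap e'.symm.injective hfin))

/-- The isomorphism classes of finite-dimensional indecomposable modules of length `n` whose
socle has endolength `e`. -/
def indecIsoclassesOfLength (k : Type v) (Γ : Type u) [Field k] [Ring Γ] [Algebra k Γ]
    (n e : ℕ) : Set (Quotient (CategoryTheory.isIsomorphicSetoid (ModuleCat.{u} Γ))) :=
  {c | ∃ M : ModuleCat.{u} Γ, Module.Finite k (RestrictScalars k Γ M) ∧
    IsIndecomposableModule Γ M ∧ Module.length Γ M = n ∧ endolength Γ (moduleSocle Γ M) = e ∧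
    Quotient.mk _ M = c}

/-- Here `d = n * e` with both factors positive, so each is at most `d`. -/
theorem indecIsoclasses_subset (hΓ : IsBoundedPID Γ) (d : ℕ) :
    indecIsoclasses k Γ d ⊆ ⋃ x ∈ (Finset.range (d + 1) ×ˢ Finset.range (d + 1)),
      indecIsoclassesOfLength k Γ x.1 x.2 := by
  rintro c ⟨M, hfin, hM, hd, rfl⟩
  obtain ⟨_, _⟩ := isNoetherian_and_isArtinian_of_finite hfin
  obtain ⟨n, hn⟩ := ENat.ne_top_iff_exists.1 (Module.length_ne_top (R := Γ) (M := M))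
  have hE := hΓ.endolength_eq hM hn.symm
  rw [hd] at hE
  have := hM.1
  have hs := hΓ.isSimpleModule_moduleSocle hM hn.symm
  have := IsSimpleModule.nontrivial Γ (moduleSocle Γ M)
  have hn0 : n ≠ 0 := by
    rintro rfl
    exact (Module.length_pos (R := Γ) (M := M)).ne hn
  have he0 : endolength Γ (moduleSocle Γ M) ≠ 0 := Module.length_pos.ne'
  have het : endolength Γ (moduleSocle Γ M) ≠ ⊤ := by
    intro h
    rw [h, ENat.mul_top (by exact_mod_cast hn0)] at hE
    exact ENat.natCast_ne_top _ hE
  obtain ⟨e, he⟩ := ENat.ne_top_iff_exists.1 het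
  rw [← he] at hE he0
  have hE' : d = n * e := by exact_mod_cast hE
  have he0' : e ≠ 0 := by exact_mod_cast he0
  simp only [Set.mem_iUnion]
  refine ⟨(n, e), ?_, M, hfin, hM, hn.symm, he.symm, rfl⟩
  rw [Finset.mem_product, Finset.mem_range, Finset.mem_range, hE']
  exact ⟨Nat.lt_succ_of_le (Nat.le_mul_of_pos_right _ (Nat.pos_of_ne_zero he0')),
    Nat.lt_succ_of_le (Nat.le_mul_of_pos_left _ (Nat.pos_of_ne_zero hn0))⟩

/-- Replace each module by the one of length `m` with the same socle. This is injective on classes,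
since the original is recovered from `n` and its socle. -/
theorem infinite_indecIsoclasses (hΓ : IsBoundedPID Γ) (hu : ∃ a : Γ, a ≠ 0 ∧ ¬ IsUnit a)
    {n e : ℕ} (hinf : (indecIsoclassesOfLength k Γ n e).Infinite) {m : ℕ} (hm : 1 ≤ m) :
    (indecIsoclasses k Γ (m * e)).Infinite := by
  have key : ∀ c ∈ indecIsoclassesOfLength k Γ n e, ∃ c' ∈ indecIsoclasses k Γ (m * e),
      ∃ M M' : ModuleCat.{u} Γ, Quotient.mk _ M = c ∧ Quotient.mk _ M' = c' ∧
        IsIndecomposableModule Γ M ∧ Module.length Γ M = n ∧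
        Nonempty (moduleSocle Γ M' ≃ₗ[Γ] moduleSocle Γ M) := by
    rintro c ⟨M, hfin, hM, hn, he, rfl⟩
    have hs := hΓ.isSimpleModule_moduleSocle hM hn
    obtain ⟨M', _, _, hM', hm', ⟨f⟩⟩ := hΓ.exists_indecomposable hu (moduleSocle Γ M) hm
    have hfin' := hΓ.finite_of_finite_moduleSocle (k := k) hu hM' hm'
      (finite_restrictScalars_of_injective ((moduleSocle Γ M).subtype ∘ₗ f.toLinearMap)
        ((Submodule.injective_subtype _).comp f.injective) hfin)
    refine ⟨Quotient.mk _ (ModuleCat.of Γ M'), ⟨ModuleCat.of Γ M', hfin', hM', ?_, rfl⟩,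
      M, ModuleCat.of Γ M', rfl, rfl, hM, hn, ⟨f⟩⟩
    change endolength Γ M' = _
    rw [hΓ.endolength_eq hM' hm', endolength_congr f, he, Nat.cast_mul]
  choose! F hF hF' using key
  refine Set.infinite_of_injOn_mapsTo (f := F) ?_ hF hinf
  intro c₁ h₁ c₂ h₂ h
  obtain ⟨M₁, M₁', rfl, hc₁, hM₁, hn₁, ⟨e₁⟩⟩ := hF' c₁ h₁
  obtain ⟨M₂, M₂', rfl, hc₂, hM₂, hn₂, ⟨e₂⟩⟩ := hF' c₂ h₂
  rw [h, ← hc₂] at hc₁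
  obtain ⟨i⟩ := Quotient.exact hc₁
  obtain ⟨j⟩ := nonempty_moduleSocle_equiv i.toLinearEquiv
  obtain ⟨g⟩ := hΓ.nonempty_equiv_of_moduleSocle_equiv hM₁ hn₁ hM₂ hn₂
    (e₁.symm.trans (j.trans e₂))
  exact Quotient.sound ⟨g.toModuleIso⟩

theorem satisfiesEBTII (hΓ : IsBoundedPID Γ) (hd : ¬ IsEDiscrete k Γ) : SatisfiesEBTII k Γ := by
  rw [IsEDiscrete, not_forall] at hd
  obtain ⟨d, hd⟩ := hd
  -- Over a division ring there is only one class of indecomposables, so no set of classes is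
  -- infinite.
  have hu : ∃ a : Γ, a ≠ 0 ∧ ¬ IsUnit a := by
    by_contra hu
    have := hΓ.isSimpleModule_self hu
    refine hd (Set.Subsingleton.finite ?_)
    rintro _ ⟨M, -, hM, -, rfl⟩ _ ⟨N, -, hN, -, rfl⟩
    have := hM.isSimpleModule
    have := hN.isSimpleModule
    obtain ⟨eM⟩ := IsSimpleModule.nonempty_equiv_self (Γ := Γ) (M := M)
    obtain ⟨eN⟩ := IsSimpleModule.nonempty_equiv_self (Γ := Γ) (M := N)
    exact Quotient.sound ⟨(eM.symm.trans eN).toModuleIso⟩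
  obtain ⟨⟨n, e⟩, hinf⟩ : ∃ x : ℕ × ℕ, (indecIsoclassesOfLength k Γ x.1 x.2).Infinite := by
    by_contra! h
    exact hd (((Finset.finite_toSet _).biUnion fun x _ => h x).subset
      (hΓ.indecIsoclasses_subset d))
  have he : e ≠ 0 := by
    rintro rfl
    obtain ⟨_, M, -, hM, hn, he, -⟩ := hinf.nonempty
    have hs := hΓ.isSimpleModule_moduleSocle hM hn
    have := IsSimpleModule.nontrivial Γ (moduleSocle Γ M)
    exact Module.length_pos.ne' he
  -- The factor `i + 1` is a length, hence starts at `1`; `e > 0` makes the sequence strictly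
  -- increasing.
  exact ⟨fun i => (i + 1) * e,
    fun i j hij => Nat.mul_lt_mul_of_pos_right (by omega) (Nat.pos_of_ne_zero he),
    fun i => hΓ.infinite_indecIsoclasses hu hinf (by omega)⟩

end IsBoundedPID

/-- Let `Γ` be a bounded principal ideal domain over a perfect field `k`.
(1) An indecomposable `Γ`-module `M` of finite length `n` has a simple socle `M₁`, and the
endolength of `M` is `n` times that of `M₁`.
(2), (3) These modules `M` are determined up to isomorphism by `n` and `M₁`, and they exist for
all `n ≥ 1` and all simple `M₁` as soon as `Γ` is not a division ring.
(4) If `Γ` is not `e`-discrete, it satisfies EBTII. -/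
theorem corollaryC {k : Type v} [Field k] [PerfectField k]
    {Γ : Type u} [Ring Γ] [Algebra k Γ] (hΓ : IsBoundedPID Γ) :
    (∀ (M : Type u) [AddCommGroup M] [Module Γ M] (n : ℕ),
      IsIndecomposableModule Γ M → Module.length Γ M = (n : ℕ∞) →
        IsSimpleModule Γ (moduleSocle Γ M) ∧
        endolength Γ M = (n : ℕ∞) * endolength Γ (moduleSocle Γ M)) ∧
    (∀ (M N : Type u) [AddCommGroup M] [Module Γ M] [AddCommGroup N] [Module Γ N] (n : ℕ),
      IsIndecomposableModule Γ M → Module.length Γ M = (n : ℕ∞) →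
      IsIndecomposableModule Γ N → Module.length Γ N = (n : ℕ∞) →
      Nonempty (moduleSocle Γ M ≃ₗ[Γ] moduleSocle Γ N) → Nonempty (M ≃ₗ[Γ] N)) ∧
    ((∃ a : Γ, a ≠ 0 ∧ ¬ IsUnit a) →
      ∀ (S : Type u) [AddCommGroup S] [Module Γ S], IsSimpleModule Γ S → ∀ n : ℕ, 1 ≤ n →
        ∃ (M : Type u) (_ : AddCommGroup M) (_ : Module Γ M),
          IsIndecomposableModule Γ M ∧ Module.length Γ M = (n : ℕ∞) ∧
          Nonempty (moduleSocle Γ M ≃ₗ[Γ] S)) ∧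
    (¬ IsEDiscrete k Γ → SatisfiesEBTII k Γ) := by
  refine ⟨fun M _ _ n hM hn => ⟨hΓ.isSimpleModule_moduleSocle hM hn, hΓ.endolength_eq hM hn⟩,
    fun M N _ _ _ _ n hM hnM hN hnN ⟨e⟩ =>
      hΓ.nonempty_equiv_of_moduleSocle_equiv hM hnM hN hnN e,
    fun hu S _ _ hS n hn => hΓ.exists_indecomposable hu S hn, hΓ.satisfiesEBTII⟩
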